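/- Let $\beta\ge 0$, $c>0$, $\eta>0$, and let $\psi(t)=\int_0^1 t^s\,ds$ for $t\ge 0$ (so $\psi(t)=\frac{t-1}{\log t}$ for $t>0$, $t\neq 1$, $\psi(1)=1$, $\psi(0)=0$), an increasing bijection of $[0,\infty)$ with inverse $\psi^{-1}$. Let $0<\xi_1<\xi_2<\cdots$ be the points of a unit-rate Poisson process on $(0,\infty)$, i.e. $\xi_1,\xi_2-\xi_1,\xi_3-\xi_2,\ldots$ are i.i.d. exponential with rate $1$, and for $j\ge 1$ put $$T_j=\psi^{-1}\Big(\frac{\xi_j}{\eta}+\psi(\beta)\Big)-\beta .$$ Given $(T_i)_{i\ge1}$, let $S_1,S_2,\ldots$ be independent, $S_j$ having density on $(0,1)$ proportional to $s\mapsto s\,(T_j+\beta)^s$; given $(T_i)_{i\ge1}$ and $(S_i)_{i\ge1}$, let $W'_1,W'_2,\ldots$ be independent, $W'_j$ having the gamma distribution with shape $1-S_j$ and rate $T_j+\beta$. Let $W_j=cW'_j$. (These are the size-biased weights of the mixed generalized gamma completely random measure with parameters $\alpha=1$, $\tau=0$, $\beta$, $c$, $\eta$.) Then, almost surely, $\sum_{j\ge1}W_j<\infty$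 and the remaining mass $R_n=\sum_{j>n}W_j$ satisfies $$R_n\sim\frac{c\,\eta}{\log n}\qquad\text{as } n\to\infty,$$ that is, $R_n\log(n)/(c\eta)\to 1$. -/

import Mathlib

open MeasureTheory ProbabilityTheory Filter Set Asymptotics
open scoped Topology

noncomputable section

/-- The Laplace exponent `t ^ s` of the stable completely random measure of index `s`. -/
def stableLaplaceExponent (t s : ℝ) : ℝ := t ^ s

/-- The Laplace exponent of the mixed stable completely random measure with parameters
`0 ≤ τ < α ≤ 1`, for `t ≥ 0`: the average of the stable exponents over `s ∈ (τ, α)`. For `t > 0`,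
`t ≠ 1` it equals `(t ^ α - t ^ τ) / ((α - τ) * log t)`; it is `1` at `t = 1` and `0` at `t = 0`. -/
def mStLaplaceExponent (α τ t : ℝ) : ℝ :=
  (1 / (α - τ)) * ∫ s in τ..α, stableLaplaceExponent t s

/-- The inverse of the increasing bijection `mStLaplaceExponent α τ : [0, ∞) → [0, ∞)`. -/
def mStLaplaceExponentInv (α τ y : ℝ) : ℝ :=
  Function.invFunOn (mStLaplaceExponent α τ) (Ici 0) y

/-- The probability distribution on `(τ, α)` whose density is proportional to `s * z ^ s`
(for `z > 0`). -/
def mixingLaw (α τ z : ℝ) : Measure ℝ :=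
  (volume.restrict (Ioo τ α)).withDensity fun s =>
    ENNReal.ofReal (s * z ^ s / ∫ u in τ..α, u * z ^ u)

/-- The gaps `ξ₁, ξ₂ - ξ₁, ξ₃ - ξ₂, …` of a sequence; the term `ξ_{j+1}` is stored at index `j`. -/
def gaps {Ω : Type*} (ξ : ℕ → Ω → ℝ) : ℕ → Ω → ℝ
  | 0 => ξ 0
  | j + 1 => fun ω => ξ (j + 1) ω - ξ j ω

/-- Conditionally on the σ-algebra `m`, the variables `X 0, X 1, …` are independent and `X j` has
(random) law `κ j`. -/
def CondIndepWithLaws {Ω : Type*} [MeasurableSpace Ω] (P : Measure Ω) (m : MeasurableSpace Ω)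
    (X : ℕ → Ω → ℝ) (κ : ℕ → Ω → Measure ℝ) : Prop :=
  ∀ (J : Finset ℕ) (A : ℕ → Set ℝ), (∀ j, MeasurableSet (A j)) →
    P⟦{ω | ∀ j ∈ J, X j ω ∈ A j}|m⟧ =ᵐ[P] fun ω => ∏ j ∈ J, (κ j ω).real (A j)

/-- The σ-algebra generated by a sequence of random variables. -/
abbrev sigmaOf {Ω : Type*} (X : ℕ → Ω → ℝ) : MeasurableSpace Ω :=
  ⨆ j, MeasurableSpace.comap (X j) inferInstance

/-- `W` is a sequence of weights sampled, through the auxiliary variables `ξ`, `T`, `S`, `W'`, by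
the size-biased algorithm for the mixed generalized gamma completely random measure with parameters
`α, τ, β, c, η`. The quantity with index `j ≥ 1` in the algorithm is stored at index `j - 1`. -/
structure IsSizeBiasedSample {Ω : Type*} [MeasurableSpace Ω] (P : Measure Ω) (α τ β c η : ℝ)
    (ξ T S W' W : ℕ → Ω → ℝ) : Prop where
  measurable_ξ : ∀ j, Measurable (ξ j)
  measurable_T : ∀ j, Measurable (T j)
  measurable_S : ∀ j, Measurable (S j)
  measurable_W' : ∀ j, Measurable (W' j)
  /-- The gaps of `ξ` are independent. -/
  indep_gaps : iIndepFun (gaps ξ) P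
  /-- The gaps of `ξ` are exponential with rate one. -/
  law_gaps : ∀ j, P.map (gaps ξ j) = expMeasure 1
  T_eq : ∀ j ω, T j ω =
    mStLaplaceExponentInv α τ (ξ j ω / η + mStLaplaceExponent α τ β) - β
  /-- Given all the `T j`, the `S j` are independent, with density proportional to
  `s * (T j + β) ^ s` on `(τ, α)`. -/
  law_S : CondIndepWithLaws P (sigmaOf T) S fun j ω => mixingLaw α τ (T j ω + β)
  /-- Given all the `T j` and `S j`, the `W' j` are independent, gamma with shape `1 - S j` and rate
  `T j + β`. -/
  law_W' : CondIndepWithLaws P (sigmaOf T ⊔ sigmaOf S) W' fun j ω =>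
    gammaMeasure (1 - S j ω) (T j ω + β)
  W_eq : ∀ j ω, W j ω = c * W' j ω

/-- The mass `R_n = ∑_{j > n} W_j` remaining after the first `n` weights, `W_j` being stored at
index `j - 1`. -/
def remainingMass {Ω : Type*} (W : ℕ → Ω → ℝ) (n : ℕ) (ω : Ω) : ℝ := ∑' j : ℕ, W (n + j) ω

end

/-! Put Z_j = T_j + β, so that ψ(Z_j) = ξ_j/η + ψ(β). The strong law gives ξ_j ~ j, hence ψ(Z_j) ~
j/η. Since ψ(z) = (z - 1)/log z and log ψ(z) ~ log z, this forces Z_j ~ (j/η) log j. Given T, the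
weight W'_j has mean m(Z_j) = E[1 - S_j | T]/Z_j. The density s z^s concentrates near s = 1 at scale
1/log z, so m(z) ~ 1/(z log z) and m(Z_j) ~ η/(j log² j) (`tendsto_weightMean_mul`). Comparison with
the differences of 1/log n shows that the tails of ∑ m(Z_j) are equivalent to η/log n.

The error splits as W' - m(Z) = (W' - (1 - S)/Z) + ((1 - S)/Z - m(Z)). Each part, cut off where Z_j
< δ(j + 1), is centred and orthogonal with second moment O(1/j²); almost surely the cutoffs act only
finitely often. The block sums over [2^k, 2^(k+1)) then have variance O(2^(-k)) and almost surely
decay geometrically, so the error in the tail at 2^K is negligible against 1/K. The weights are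
nonnegative, so tails are monotone and the powers of two control every n
(`summable_and_tendsto_tail_mul_log`). No maximal inequality inside the blocks is needed. -/

/-! ### Gamma and mixing laws as Markov kernels, and their moments -/

/-- The identity on positive reals, and `1` elsewhere. -/
noncomputable def clampPos (x : ℝ) : ℝ := if 0 < x then x else 1

lemma clampPos_pos (x : ℝ) : 0 < clampPos x := by
  unfold clampPos; split_ifs with h
  · exact h
  · exact one_pos

lemma clampPos_of_pos {x : ℝ} (hx : 0 < x) : clampPos x = x := if_pos hx

@[fun_prop]
lemma measurable_clampPos : Measurable clampPos :=
  Measurable.ite measurableSet_Ioi measurable_id measurable_const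

/-- Clamping makes Euler's integral valid for every x, so measurability follows from that of a
parametric integral. -/
lemma measurable_Gamma_clampPos : Measurable fun x => Real.Gamma (clampPos x) := by
  have h : (fun x => Real.Gamma (clampPos x)) =
      fun x => ∫ y in Ioi (0 : ℝ), Real.exp (-y) * y ^ (clampPos x - 1) := by
    funext x
    exact Real.Gamma_eq_integral (clampPos_pos x)
  rw [h]
  have : Measurable (Function.uncurry fun x y : ℝ => Real.exp (-y) * y ^ (clampPos x - 1)) := by
    unfold Function.uncurry
    fun_prop
  exact this.stronglyMeasurable.integral_prod_right.measurable

lemma measurable_gammaPDF_clampPos :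
    Measurable fun p : (ℝ × ℝ) × ℝ => gammaPDF (clampPos (1 - p.1.1)) (clampPos p.1.2) p.2 := by
  unfold gammaPDF gammaPDFReal
  refine ENNReal.measurable_ofReal.comp (Measurable.ite ?_ ?_ measurable_const)
  · exact measurableSet_le measurable_const measurable_snd
  · have := measurable_Gamma_clampPos.comp (g := fun x => Real.Gamma (clampPos x))
      (f := fun p : (ℝ × ℝ) × ℝ => 1 - p.1.1) (by fun_prop)
    have h2 : Measurable fun p : (ℝ × ℝ) × ℝ => Real.Gamma (clampPos (1 - p.1.1)) := this
    fun_prop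

lemma lintegral_gammaMeasure (a r : ℝ) (f : ℝ → ENNReal) :
    ∫⁻ x, f x ∂gammaMeasure a r = ∫⁻ x, gammaPDF a r x * f x := by
  have h : Measurable (gammaPDF a r) := by unfold gammaPDF; fun_prop
  rw [gammaMeasure, lintegral_withDensity_eq_lintegral_mul_non_measurable _ h]
  · rfl
  · exact ae_of_all _ fun x => ENNReal.ofReal_lt_top

/-- Size-biasing a gamma law raises its shape by one; applied once or twice, this yields the first
two moments. -/
lemma mul_gammaPDF {a r : ℝ} (ha : 0 < a) (hr : 0 < r) (x : ℝ) :
    gammaPDF a r x * ENNReal.ofReal x = ENNReal.ofReal (a / r) * gammaPDF (a + 1) r x := by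
  unfold gammaPDF
  rw [← ENNReal.ofReal_mul (gammaPDFReal_nonneg ha hr x), ← ENNReal.ofReal_mul (by positivity)]
  congr 1
  unfold gammaPDFReal
  split_ifs with h
  · rcases h.eq_or_lt with rfl | h
    · simp [ha.ne']
    · rw [Real.Gamma_add_one ha.ne', Real.rpow_add_one hr.ne', Real.rpow_sub_one h.ne',
        add_sub_cancel_right]
      have := (Real.Gamma_pos_of_pos ha).ne'
      field_simp
  · simp

lemma lintegral_ofReal_gammaMeasure {a r : ℝ} (ha : 0 < a) (hr : 0 < r) :
    ∫⁻ x, ENNReal.ofReal x ∂gammaMeasure a r = ENNReal.ofReal (a / r) := by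
  have h : Measurable (gammaPDF (a + 1) r) := by unfold gammaPDF; fun_prop
  rw [lintegral_gammaMeasure]
  simp_rw [mul_gammaPDF ha hr]
  rw [lintegral_const_mul _ h, lintegral_gammaPDF_eq_one (by positivity) hr, mul_one]

lemma ae_nonneg_gammaMeasure (a r : ℝ) : ∀ᵐ x ∂gammaMeasure a r, 0 ≤ x := by
  rw [ae_iff, gammaMeasure]
  have : {x : ℝ | ¬ 0 ≤ x} = Iio 0 := by ext; simp
  rw [this, withDensity_apply _ measurableSet_Iio, lintegral_gammaPDF_of_nonpos le_rfl]

lemma ae_pos_gammaMeasure (a r : ℝ) : ∀ᵐ x ∂gammaMeasure a r, 0 < x := by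
  have h : ∀ᵐ x ∂gammaMeasure a r, x ≠ 0 := by
    have : gammaMeasure a r ≪ volume := withDensity_absolutelyContinuous _ _
    exact this.ae_le (Measure.ae_ne volume 0)
  filter_upwards [ae_nonneg_gammaMeasure a r, h] with x h1 h2
  exact lt_of_le_of_ne h1 h2.symm

lemma lintegral_ofReal_sq_gammaMeasure {a r : ℝ} (ha : 0 < a) (hr : 0 < r) :
    ∫⁻ x, ENNReal.ofReal (x ^ 2) ∂gammaMeasure a r = ENNReal.ofReal (a * (a + 1) / r ^ 2) := by
  have h1 : ∫⁻ x, ENNReal.ofReal (x ^ 2) ∂gammaMeasure a r =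
      ∫⁻ x, ENNReal.ofReal x * ENNReal.ofReal x ∂gammaMeasure a r := by
    refine lintegral_congr_ae ?_
    filter_upwards [ae_nonneg_gammaMeasure a r] with x hx
    rw [← ENNReal.ofReal_mul hx, sq]
  have h : Measurable (gammaPDF (a + 1) r) := by unfold gammaPDF; fun_prop
  rw [h1, lintegral_gammaMeasure]
  simp_rw [← mul_assoc, mul_gammaPDF ha hr, mul_assoc]
  rw [lintegral_const_mul _ (by fun_prop), ← lintegral_gammaMeasure,
    lintegral_ofReal_gammaMeasure (by positivity) hr, ← ENNReal.ofReal_mul (by positivity)]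
  congr 1
  field_simp

lemma integrable_id_gammaMeasure {a r : ℝ} (ha : 0 < a) (hr : 0 < r) :
    Integrable (fun x => x) (gammaMeasure a r) := by
  refine ⟨by fun_prop, ?_⟩
  rw [hasFiniteIntegral_iff_ofReal (ae_nonneg_gammaMeasure a r),
    lintegral_ofReal_gammaMeasure ha hr]
  exact ENNReal.ofReal_lt_top

lemma integral_id_gammaMeasure {a r : ℝ} (ha : 0 < a) (hr : 0 < r) :
    ∫ x, x ∂gammaMeasure a r = a / r := by
  rw [integral_eq_lintegral_of_nonneg_ae (ae_nonneg_gammaMeasure a r) (by fun_prop),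
    lintegral_ofReal_gammaMeasure ha hr, ENNReal.toReal_ofReal (by positivity)]

/-- The gamma distribution with shape `1 - s` and rate `z` as a kernel in `(s, z)`, each parameter
being replaced by `1` if it is not positive. -/
noncomputable def gammaKernel : Kernel (ℝ × ℝ) ℝ where
  toFun p := gammaMeasure (clampPos (1 - p.1)) (clampPos p.2)
  measurable' := by
    refine Measure.measurable_of_measurable_coe _ fun s hs => ?_
    simp_rw [gammaMeasure, withDensity_apply _ hs]
    exact measurable_gammaPDF_clampPos.lintegral_prod_right'

lemma gammaKernel_apply (p : ℝ × ℝ) :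
    gammaKernel p = gammaMeasure (clampPos (1 - p.1)) (clampPos p.2) := rfl

instance : IsMarkovKernel gammaKernel :=
  ⟨fun _ => isProbabilityMeasure_gammaMeasure (clampPos_pos _) (clampPos_pos _)⟩

lemma continuous_mul_rpow {z : ℝ} (hz : 0 < z) : Continuous fun u : ℝ => u * z ^ u :=
  continuous_id.mul (Real.continuous_const_rpow hz.ne')

lemma integral_mul_rpow_pos {z : ℝ} (hz : 0 < z) : 0 < ∫ u in (0 : ℝ)..1, u * z ^ u := by
  refine intervalIntegral.intervalIntegral_pos_of_pos_on
    ((continuous_mul_rpow hz).intervalIntegrable _ _) (fun x hx => ?_) one_pos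
  have := hx.1
  positivity

/-- The distribution `mixingLaw 1 0 z` as a kernel in `z`, with `z` replaced by `1` if it is not
positive. -/
noncomputable def mixingKernel : Kernel ℝ ℝ where
  toFun z := mixingLaw 1 0 (clampPos z)
  measurable' := by
    refine Measure.measurable_of_measurable_coe _ fun s hs => ?_
    simp_rw [mixingLaw, withDensity_apply _ hs]
    have h1 : Measurable fun z : ℝ => ∫ u in (0 : ℝ)..1, u * (clampPos z) ^ u := by
      simp_rw [intervalIntegral.integral_of_le zero_le_one]
      have : Measurable (Function.uncurry fun z u : ℝ => u * (clampPos z) ^ u) := by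
        unfold Function.uncurry
        fun_prop
      exact this.stronglyMeasurable.integral_prod_right.measurable
    have h2 : Measurable fun p : ℝ × ℝ => ∫ u in (0 : ℝ)..1, u * (clampPos p.1) ^ u :=
      h1.comp measurable_fst
    have h3 : Measurable fun p : ℝ × ℝ =>
        ENNReal.ofReal (p.2 * clampPos p.1 ^ p.2 / ∫ u in (0 : ℝ)..1, u * (clampPos p.1) ^ u) := by
      fun_prop
    exact h3.lintegral_prod_right' (ν := (volume.restrict (Ioo 0 1)).restrict s)

lemma mixingKernel_apply (z : ℝ) : mixingKernel z = mixingLaw 1 0 (clampPos z) := rfl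

lemma mixingLaw_nonneg_density {z : ℝ} (hz : 0 < z) {s : ℝ} (hs : s ∈ Ioo (0 : ℝ) 1) :
    0 ≤ s * z ^ s / ∫ u in (0 : ℝ)..1, u * z ^ u := by
  have := integral_mul_rpow_pos hz
  have := hs.1
  positivity

lemma integral_mixingLaw {z : ℝ} (hz : 0 < z) (f : ℝ → ℝ) :
    ∫ s, f s ∂mixingLaw 1 0 z =
      (∫ s in (0 : ℝ)..1, s * z ^ s * f s) / ∫ u in (0 : ℝ)..1, u * z ^ u := by
  have hc := continuous_mul_rpow hz
  rw [mixingLaw, integral_withDensity_eq_integral_toReal_smul (by fun_prop)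
    (ae_of_all _ fun x => ENNReal.ofReal_lt_top), ← intervalIntegral.integral_div,
    intervalIntegral.integral_of_le (zero_le_one' ℝ) (f := fun s => _ / _),
    integral_Ioc_eq_integral_Ioo]
  refine setIntegral_congr_fun measurableSet_Ioo fun s hs => ?_
  simp only [smul_eq_mul]
  rw [ENNReal.toReal_ofReal (mixingLaw_nonneg_density hz hs)]
  ring

lemma isProbabilityMeasure_mixingLaw {z : ℝ} (hz : 0 < z) :
    IsProbabilityMeasure (mixingLaw 1 0 z) := by
  constructor
  have hc := continuous_mul_rpow hz
  rw [mixingLaw, withDensity_apply _ MeasurableSet.univ, Measure.restrict_univ,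
    ← ofReal_integral_eq_lintegral_ofReal]
  · rw [← integral_Ioc_eq_integral_Ioo, ← intervalIntegral.integral_of_le zero_le_one,
      intervalIntegral.integral_div, div_self (integral_mul_rpow_pos hz).ne', ENNReal.ofReal_one]
  · refine (Integrable.div_const ?_ _)
    exact (hc.integrableOn_Icc (a := 0) (b := 1)).mono_set Ioo_subset_Icc_self
  · exact (ae_restrict_iff' measurableSet_Ioo).2 (ae_of_all _ fun s hs =>
      mixingLaw_nonneg_density hz hs)

instance : IsMarkovKernel mixingKernel :=
  ⟨fun z => isProbabilityMeasure_mixingLaw (clampPos_pos z)⟩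

lemma ae_mem_Ioo_mixingLaw (z : ℝ) : ∀ᵐ s ∂mixingLaw 1 0 z, s ∈ Ioo (0 : ℝ) 1 :=
  (withDensity_absolutelyContinuous _ _).ae_le (ae_restrict_mem measurableSet_Ioo)

/-! ### Dyadic block sums of orthogonal variables -/

section Orthogonal

variable {Ω : Type*} [MeasurableSpace Ω] {P : Measure Ω} {C : ℝ}

lemma integral_sum_sq {Y : ℕ → Ω → ℝ} (hY : ∀ j, MemLp (Y j) 2 P)
    (h0 : ∀ i j, i ≠ j → ∫ ω, Y i ω * Y j ω ∂P = 0) (J : Finset ℕ) :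
    ∫ ω, (∑ j ∈ J, Y j ω) ^ 2 ∂P = ∑ j ∈ J, ∫ ω, Y j ω ^ 2 ∂P := by
  have hi : ∀ i j, Integrable (fun ω => Y i ω * Y j ω) P := fun i j =>
    (hY i).integrable_mul (hY j)
  simp_rw [sq, Finset.sum_mul_sum]
  rw [integral_finsetSum _ fun i _ => integrable_finsetSum _ fun j _ => hi i j]
  refine Finset.sum_congr rfl fun i hiJ => ?_
  rw [integral_finsetSum _ fun j _ => hi i j]
  exact Finset.sum_eq_single i (fun j _ hj => h0 i j hj.symm) fun h => absurd hiJ h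

/-- The sum of a sequence over the dyadic block `[2 ^ k, 2 ^ (k + 1))`. -/
def dyadicSum (a : ℕ → ℝ) (k : ℕ) : ℝ := ∑ j ∈ Finset.Ico (2 ^ k) (2 ^ (k + 1)), a j

/-- The dyadic block sums of the sequence decay geometrically. -/
def GeometricDyadicSums (a : ℕ → ℝ) : Prop :=
  ∃ r : ℝ, 0 ≤ r ∧ r < 1 ∧ ∀ᶠ k in atTop, |dyadicSum a k| ≤ r ^ k

/-- Block k has 2^k orthogonal terms of second moment at most C/4^k, so its sum has second moment at
most C/2^k. Weighted by (3/2)^k, the squared block sums have a finite total expectation, so almost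
surely the weighted squares are eventually below 1. -/
lemma ae_geometricDyadicSums_of_orthogonal {Y : ℕ → Ω → ℝ} (hYm : ∀ j, Measurable (Y j))
    (hY : ∀ j, ∫⁻ ω, ENNReal.ofReal (Y j ω ^ 2) ∂P ≤ ENNReal.ofReal (C / (j + 1 : ℝ) ^ 2))
    (hC : 0 ≤ C) (h0 : ∀ i j, i ≠ j → ∫ ω, Y i ω * Y j ω ∂P = 0) :
    ∀ᵐ ω ∂P, GeometricDyadicSums fun j => Y j ω := by
  have hi : ∀ j, Integrable (fun ω => Y j ω ^ 2) P := fun j => by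
    refine ⟨by have := hYm j; fun_prop, ?_⟩
    rw [hasFiniteIntegral_iff_ofReal (ae_of_all _ fun ω => sq_nonneg _)]
    exact (hY j).trans_lt ENNReal.ofReal_lt_top
  have hL : ∀ j, MemLp (Y j) 2 P := fun j =>
    (memLp_two_iff_integrable_sq (hYm j).aestronglyMeasurable).2 (hi j)
  have hle : ∀ j, ∫ ω, Y j ω ^ 2 ∂P ≤ C / (j + 1 : ℝ) ^ 2 := fun j => by
    rw [integral_eq_lintegral_of_nonneg_ae (ae_of_all _ fun ω => sq_nonneg _)
      (hi j).aestronglyMeasurable]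
    exact ENNReal.toReal_le_of_le_ofReal (by positivity) (hY j)
  have hB : ∀ k, ∫ ω, dyadicSum (fun j => Y j ω) k ^ 2 ∂P ≤ C * (1 / 2) ^ k := fun k => by
    unfold dyadicSum
    rw [integral_sum_sq hL h0]
    calc _ ≤ ∑ j ∈ Finset.Ico (2 ^ k) (2 ^ (k + 1)), C / ((2 : ℝ) ^ k) ^ 2 := by
          refine Finset.sum_le_sum fun j hj => (hle j).trans ?_
          have : ((2 ^ k : ℕ) : ℝ) ≤ j := by exact_mod_cast (Finset.mem_Ico.1 hj).1
          push_cast at this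
          gcongr
          linarith
      _ = _ := by
          rw [Finset.sum_const, Nat.card_Ico, pow_succ, mul_two, Nat.add_sub_cancel,
            nsmul_eq_mul, one_div, inv_pow]
          push_cast
          field_simp
  have hBi : ∀ k, Integrable (fun ω => dyadicSum (fun j => Y j ω) k ^ 2) P := fun k =>
    (memLp_finsetSum _ fun j _ => hL j).integrable_sq
  -- Any weight base strictly between 1 and 2 would do: above 1 for geometric decay, below 2 for
  -- summability.
  have hfin : ∫⁻ ω, ∑' k : ℕ, ENNReal.ofReal ((3 / 2) ^ k * dyadicSum (fun j => Y j ω) k ^ 2) ∂P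
      ≠ ⊤ := by
    rw [lintegral_tsum fun k => ((hBi k).const_mul _).aestronglyMeasurable.aemeasurable.ennreal_ofReal]
    have : ∀ k : ℕ, ∫⁻ ω, ENNReal.ofReal ((3 / 2) ^ k * dyadicSum (fun j => Y j ω) k ^ 2) ∂P ≤
        ENNReal.ofReal (C * (3 / 4) ^ k) := fun k => by
      rw [← ofReal_integral_eq_lintegral_ofReal ((hBi k).const_mul _)
        (ae_of_all _ fun ω => by positivity), integral_const_mul]
      refine ENNReal.ofReal_le_ofReal ?_
      calc _ ≤ (3 / 2 : ℝ) ^ k * (C * (1 / 2) ^ k) := by gcongr; exact hB k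
        _ = C * (3 / 4) ^ k := by
          rw [mul_left_comm, ← mul_pow]; norm_num
    refine ne_top_of_le_ne_top ?_ (ENNReal.tsum_le_tsum this)
    exact ((summable_geometric_of_lt_one (r := (3 / 4 : ℝ)) (by norm_num) (by norm_num)).mul_left
      C).tsum_ofReal_ne_top
  have hae := ae_lt_top' (AEMeasurable.tsum
    fun k => ((hBi k).const_mul _).aestronglyMeasurable.aemeasurable.ennreal_ofReal) hfin
  filter_upwards [hae] with ω hω
  refine ⟨Real.sqrt (2 / 3), Real.sqrt_nonneg _, ?_, ?_⟩
  · rw [Real.sqrt_lt' one_pos]; norm_num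
  · have ht := ENNReal.tendsto_cofinite_zero_of_tsum_ne_top hω.ne
    rw [Nat.cofinite_eq_atTop] at ht
    filter_upwards [ht.eventually_lt_const one_pos] with k hk
    rw [← ENNReal.ofReal_one, ENNReal.ofReal_lt_ofReal_iff one_pos] at hk
    refine abs_le_of_sq_le_sq ?_ (by positivity)
    rw [← pow_mul, mul_comm k 2, pow_mul, Real.sq_sqrt (by norm_num)]
    have h1 : (2 / 3 : ℝ) ^ k * (3 / 2) ^ k = 1 := by rw [← mul_pow]; norm_num
    have h2 : (0 : ℝ) < (2 / 3) ^ k := by positivity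
    nlinarith

end Orthogonal

/-! ### From conditional laws to joint laws and orthogonality -/

section CondIndep

variable {Ω U : Type*} {m : MeasurableSpace Ω} [mΩ : MeasurableSpace Ω] [MeasurableSpace U]
  {P : Measure Ω} [IsProbabilityMeasure P] {X : ℕ → Ω → ℝ} {κ : ℕ → Ω → Measure ℝ}

lemma CondIndepWithLaws.measure_inter (h : CondIndepWithLaws P m X κ) (hm : m ≤ mΩ)
    (hX : ∀ j, Measurable (X j)) (hκ : ∀ j, ∀ᵐ ω ∂P, IsProbabilityMeasure (κ j ω))
    (J : Finset ℕ) {A : ℕ → Set ℝ} (hA : ∀ j, MeasurableSet (A j)) {E : Set Ω}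
    (hE : MeasurableSet[m] E) :
    P (E ∩ {ω | ∀ j ∈ J, X j ω ∈ A j}) = ∫⁻ ω in E, ∏ j ∈ J, κ j ω (A j) ∂P := by
  have hS : MeasurableSet {ω | ∀ j ∈ J, X j ω ∈ A j} := by
    have : {ω | ∀ j ∈ J, X j ω ∈ A j} = ⋂ j ∈ J, X j ⁻¹' A j := by ext; simp
    rw [this]
    exact Finset.measurableSet_biInter _ fun j _ => hX j (hA j)
  have h1 := h J A hA
  -- Measurability of `κ` in ω is not assumed; it is inherited, up to null sets, from the
  -- conditional expectation.
  have h2 : Integrable (fun ω => ∏ j ∈ J, (κ j ω).real (A j)) P := integrable_condExp.congr h1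
  have h3 : ∫ ω in E, ∏ j ∈ J, (κ j ω).real (A j) ∂P =
      (P (E ∩ {ω | ∀ j ∈ J, X j ω ∈ A j})).toReal := by
    rw [← setIntegral_congr_ae (hm _ hE) (h1.mono fun ω hω _ => hω),
      setIntegral_condExp hm ((integrable_const _).indicator hS) hE,
      setIntegral_indicator hS, setIntegral_const, smul_eq_mul, mul_one]
    rfl
  rw [← ENNReal.ofReal_toReal (measure_ne_top P _), ← h3,
    ofReal_integral_eq_lintegral_ofReal h2.restrict
      (ae_of_all _ fun ω => Finset.prod_nonneg fun j _ => measureReal_nonneg)]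
  refine lintegral_congr_ae (ae_restrict_of_ae ?_)
  filter_upwards [ae_all_iff.2 hκ] with ω hω
  rw [ENNReal.ofReal_prod_of_nonneg fun j _ => measureReal_nonneg]
  exact Finset.prod_congr rfl fun j _ => ENNReal.ofReal_toReal (measure_ne_top _ _)

variable {u : ℕ → Ω → U} {K : Kernel U ℝ} [IsMarkovKernel K]

/-- Rectangles determine the joint law. Almost sure agreement of `κ` with a kernel `K` of an
`m`-measurable parameter suffices, so clamped parameters are harmless. -/
lemma CondIndepWithLaws.map_prodMk (h : CondIndepWithLaws P m X κ) (hm : m ≤ mΩ)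
    (hX : ∀ j, Measurable (X j)) (hu : ∀ j, Measurable[m] (u j))
    (hK : ∀ j, ∀ᵐ ω ∂P, κ j ω = K (u j ω)) (j : ℕ) :
    P.map (fun ω => (u j ω, X j ω)) = P.map (u j) ⊗ₘ K := by
  have hu' : ∀ j, Measurable (u j) := fun j => (hu j).mono hm le_rfl
  have hκ : ∀ j, ∀ᵐ ω ∂P, IsProbabilityMeasure (κ j ω) := fun j => by
    filter_upwards [hK j] with ω hω
    rw [hω]; infer_instance
  have : IsFiniteMeasure (P.map (fun ω => (u j ω, X j ω))) := by infer_instance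
  refine Measure.ext_prod fun {s t} hs ht => ?_
  rw [Measure.map_apply ((hu' j).prodMk (hX j)) (hs.prod ht),
    Measure.compProd_apply_prod hs ht, setLIntegral_map hs (K.measurable_coe ht) (hu' j)]
  have h1 := h.measure_inter hm hX hκ {j} (A := fun _ => t) (fun _ => ht) (hu j hs)
  simp only [Finset.mem_singleton, forall_eq, Finset.prod_singleton] at h1
  refine h1.trans (lintegral_congr_ae (ae_restrict_of_ae ?_))
  filter_upwards [hK j] with ω hω
  rw [hω]

lemma CondIndepWithLaws.map_pair (h : CondIndepWithLaws P m X κ) (hm : m ≤ mΩ)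
    (hX : ∀ j, Measurable (X j)) (hu : ∀ j, Measurable[m] (u j))
    (hK : ∀ j, ∀ᵐ ω ∂P, κ j ω = K (u j ω)) {i j : ℕ} (hij : i ≠ j) :
    P.map (fun ω => ((u i ω, u j ω), X i ω, X j ω)) =
      P.map (fun ω => (u i ω, u j ω)) ⊗ₘ (K ∥ₖ K) := by
  have hu' : ∀ j, Measurable (u j) := fun j => (hu j).mono hm le_rfl
  have hκ : ∀ j, ∀ᵐ ω ∂P, IsProbabilityMeasure (κ j ω) := fun j => by
    filter_upwards [hK j] with ω hω
    rw [hω]; infer_instance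
  have hV : Measurable[m] fun ω => (u i ω, u j ω) := (hu i).prodMk (hu j)
  have hV' : Measurable fun ω => (u i ω, u j ω) := hV.mono hm le_rfl
  refine Measure.ext_prod₃ fun {s t v} hs ht hv => ?_
  have hm' : Measurable fun ω => ((u i ω, u j ω), X i ω, X j ω) :=
    hV'.prodMk ((hX i).prodMk (hX j))
  rw [Measure.map_apply hm' (hs.prod (ht.prod hv)), Measure.compProd_apply_prod hs (ht.prod hv),
    setLIntegral_map hs (Kernel.measurable_coe _ (ht.prod hv)) hV']
  have h1 := h.measure_inter hm hX hκ {i, j} (A := fun l => if l = i then t else v)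
    (fun l => by split_ifs <;> assumption) (hV hs)
  simp only [Finset.mem_insert, Finset.mem_singleton, forall_eq_or_imp, forall_eq, if_true,
    if_neg hij.symm, Finset.prod_pair hij] at h1
  refine h1.trans (lintegral_congr_ae (ae_restrict_of_ae ?_))
  filter_upwards [hK i, hK j] with ω hi hj
  rw [Kernel.parallelComp_apply, Measure.prod_prod, hi, hj]

variable {φ : ℕ → U × ℝ → ℝ} {C : ℝ}

lemma CondIndepWithLaws.lintegral_sq_le (h : CondIndepWithLaws P m X κ) (hm : m ≤ mΩ)
    (hX : ∀ j, Measurable (X j)) (hu : ∀ j, Measurable[m] (u j))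
    (hK : ∀ j, ∀ᵐ ω ∂P, κ j ω = K (u j ω)) {j : ℕ} (hφ : Measurable (φ j)) {b : ENNReal}
    (hb : ∀ a, ∫⁻ x, ENNReal.ofReal (φ j (a, x) ^ 2) ∂K a ≤ b) :
    ∫⁻ ω, ENNReal.ofReal (φ j (u j ω, X j ω) ^ 2) ∂P ≤ b := by
  have hu' : ∀ j, Measurable (u j) := fun j => (hu j).mono hm le_rfl
  have h1 := lintegral_map (μ := P) (f := fun p => ENNReal.ofReal (φ j p ^ 2))
    (g := fun ω => (u j ω, X j ω)) (by fun_prop) ((hu' j).prodMk (hX j))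
  have := Measure.isProbabilityMeasure_map (μ := P) (hu' j).aemeasurable
  rw [← h1, h.map_prodMk hm hX hu hK, Measure.lintegral_compProd (by fun_prop)]
  refine (lintegral_mono fun a => hb a).trans ?_
  simp

/-- Given the parameters, the two variables have a product law, so the inner integral factorises
into centred factors. The L² hypothesis justifies Fubini. -/
lemma CondIndepWithLaws.integral_mul_eq_zero (h : CondIndepWithLaws P m X κ) (hm : m ≤ mΩ)
    (hX : ∀ j, Measurable (X j)) (hu : ∀ j, Measurable[m] (u j))
    (hK : ∀ j, ∀ᵐ ω ∂P, κ j ω = K (u j ω)) (hφ : ∀ j, Measurable (φ j))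
    (hφ2 : ∀ j, MemLp (fun ω => φ j (u j ω, X j ω)) 2 P)
    (h0 : ∀ j a, ∫ x, φ j (a, x) ∂K a = 0) {i j : ℕ} (hij : i ≠ j) :
    ∫ ω, φ i (u i ω, X i ω) * φ j (u j ω, X j ω) ∂P = 0 := by
  have hu' : ∀ j, Measurable (u j) := fun j => (hu j).mono hm le_rfl
  have hV' : Measurable fun ω => (u i ω, u j ω) := (hu' i).prodMk (hu' j)
  have hm' : Measurable fun ω => ((u i ω, u j ω), X i ω, X j ω) :=
    hV'.prodMk ((hX i).prodMk (hX j))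
  let F : (U × U) × ℝ × ℝ → ℝ := fun p => φ i (p.1.1, p.2.1) * φ j (p.1.2, p.2.2)
  have hF : Measurable F := by
    have := hφ i
    have := hφ j
    fun_prop
  have h1 : ∫ ω, F ((u i ω, u j ω), X i ω, X j ω) ∂P = _ :=
    (integral_map hm'.aemeasurable hF.aestronglyMeasurable).symm
  have hint : Integrable F (P.map fun ω => ((u i ω, u j ω), X i ω, X j ω)) :=
    (integrable_map_measure hF.aestronglyMeasurable hm'.aemeasurable).2
      ((hφ2 i).integrable_mul (hφ2 j))
  change ∫ ω, F ((u i ω, u j ω), X i ω, X j ω) ∂P = 0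
  rw [h.map_pair hm hX hu hK hij] at hint h1
  rw [h1, Measure.integral_compProd hint]
  refine integral_eq_zero_of_ae (ae_of_all _ fun a => ?_)
  simp only [F, Kernel.parallelComp_apply]
  rw [integral_prod_mul (fun x => φ i (a.1, x)) (fun y => φ j (a.2, y)), h0, zero_mul]
  rfl

lemma CondIndepWithLaws.ae_geometricDyadicSums (h : CondIndepWithLaws P m X κ) (hm : m ≤ mΩ)
    (hX : ∀ j, Measurable (X j)) (hu : ∀ j, Measurable[m] (u j))
    (hK : ∀ j, ∀ᵐ ω ∂P, κ j ω = K (u j ω)) (hφ : ∀ j, Measurable (φ j)) (hC : 0 ≤ C)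
    (h0 : ∀ j a, ∫ x, φ j (a, x) ∂K a = 0)
    (hφ2 : ∀ j a, ∫⁻ x, ENNReal.ofReal (φ j (a, x) ^ 2) ∂K a ≤
      ENNReal.ofReal (C / (j + 1 : ℝ) ^ 2)) :
    ∀ᵐ ω ∂P, GeometricDyadicSums fun j => φ j (u j ω, X j ω) := by
  have hu' : ∀ j, Measurable (u j) := fun j => (hu j).mono hm le_rfl
  have hY : ∀ j, Measurable fun ω => φ j (u j ω, X j ω) := fun j =>
    (hφ j).comp ((hu' j).prodMk (hX j))
  have hle := fun j => h.lintegral_sq_le hm hX hu hK (hφ j) (hφ2 j)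
  have hL : ∀ j, MemLp (fun ω => φ j (u j ω, X j ω)) 2 P := fun j => by
    refine (memLp_two_iff_integrable_sq (hY j).aestronglyMeasurable).2
      ⟨((hY j).pow_const 2).aestronglyMeasurable, ?_⟩
    rw [hasFiniteIntegral_iff_ofReal (ae_of_all _ fun ω => sq_nonneg _)]
    exact (hle j).trans_lt ENNReal.ofReal_lt_top
  exact ae_geometricDyadicSums_of_orthogonal hY hle hC fun i j hij =>
    h.integral_mul_eq_zero hm hX hu hK hφ hL h0 hij

end CondIndep

/-! ### Deterministic tail asymptotics -/

lemma hasSum_telescope {D : ℕ → ℝ} (hD0 : Tendsto D atTop (𝓝 0)) {N : ℕ}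
    (hD : ∀ j, N ≤ j → D (j + 1) ≤ D j) {n : ℕ} (hn : N ≤ n) :
    HasSum (fun j => D (n + j) - D (n + j + 1)) (D n) := by
  rw [hasSum_iff_tendsto_nat_of_nonneg fun j => sub_nonneg.2 (hD _ (by omega))]
  have h : ∀ k, ∑ j ∈ Finset.range k, (D (n + j) - D (n + j + 1)) = D n - D (n + k) := fun k =>
    Finset.sum_range_sub' (fun j => D (n + j)) k
  simp_rw [h]
  have h1 : Tendsto (fun k => D (n + k)) atTop (𝓝 0) := by
    simp_rw [add_comm n]
    exact (tendsto_add_atTop_iff_nat n).2 hD0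
  simpa using h1.const_sub (D n)

/-- A Stolz–Cesàro theorem for tails: the termwise bound |a_j - l(D_j - D_{j+1})| ≤ (ε/2)(D_j -
D_{j+1}) sums from n on to an error of at most (ε/2) D_n. -/
lemma tendsto_tail_div_of_telescope {D a : ℕ → ℝ} {l : ℝ} (hD0 : Tendsto D atTop (𝓝 0))
    (hD : ∀ᶠ j in atTop, D (j + 1) < D j)
    (ha : Tendsto (fun j => a j / (D j - D (j + 1))) atTop (𝓝 l)) :
    Summable a ∧ Tendsto (fun n => (∑' j, a (n + j)) / D n) atTop (𝓝 l) := by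
  obtain ⟨N, hN⟩ := eventually_atTop.1 hD
  have hs := fun n (hn : N ≤ n) => hasSum_telescope hD0 (fun j hj => (hN j hj).le) hn
  have hd : Summable fun j => D j - D (j + 1) := by
    rw [← summable_nat_add_iff N]
    simpa [add_comm, add_left_comm] using (hs N le_rfl).summable
  have hO : a =O[atTop] fun j => D j - D (j + 1) := by
    refine isBigO_of_div_tendsto_nhds ?_ l ha
    filter_upwards [hD] with j hj h0
    linarith
  have hsum : Summable a := summable_of_isBigO_nat hd hO
  refine ⟨hsum, ?_⟩
  rw [Metric.tendsto_atTop]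
  intro ε hε
  obtain ⟨N', hN'⟩ := (Metric.tendsto_atTop.1 ha) (ε / 2) (by positivity)
  refine ⟨max N N', fun n hn => ?_⟩
  have hn1 : N ≤ n := le_trans (le_max_left _ _) hn
  have hn2 : N' ≤ n := le_trans (le_max_right _ _) hn
  have hDn : 0 < D n := by
    have h1 := (hs (n + 1) (by omega)).nonneg fun j => sub_nonneg.2 (hN _ (by omega)).le
    linarith [hN n hn1]
  have hbound : ∀ j, ‖a (n + j) - l * (D (n + j) - D (n + j + 1))‖ ≤
      ε / 2 * (D (n + j) - D (n + j + 1)) := fun j => by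
    have h1 := hN' (n + j) (by omega)
    have h2 : 0 < D (n + j) - D (n + j + 1) := sub_pos.2 (hN _ (by omega))
    rw [Real.dist_eq, div_sub' h2.ne', abs_div, abs_of_pos h2, div_lt_iff₀ h2] at h1
    rw [Real.norm_eq_abs, mul_comm l]
    exact h1.le
  have ha' : Summable fun j => a (n + j) := by
    simpa [add_comm] using (summable_nat_add_iff n).2 hsum
  have h3 := tsum_of_norm_bounded ((hs n hn1).mul_left (ε / 2)) hbound
  rw [ha'.tsum_sub ((hs n hn1).summable.mul_left l), tsum_mul_left, (hs n hn1).tsum_eq] at h3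
  rw [Real.dist_eq, div_sub' hDn.ne', abs_div, abs_of_pos hDn, div_lt_iff₀ hDn, mul_comm (D n)]
  rw [Real.norm_eq_abs] at h3
  nlinarith

lemma tendsto_log_natCast : Tendsto (fun n : ℕ => Real.log n) atTop atTop :=
  Real.tendsto_log_atTop.comp tendsto_natCast_atTop_atTop

lemma tendsto_mul_sub_log_add_one :
    Tendsto (fun n : ℕ => (n : ℝ) * (Real.log (n + 1) - Real.log n)) atTop (𝓝 1) := by
  have h := (Real.tendsto_mul_log_one_add_div_atTop 1).comp (tendsto_natCast_atTop_atTop (R := ℝ))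
  refine h.congr' ?_
  filter_upwards [eventually_gt_atTop 0] with n hn
  have hn' : (0 : ℝ) < n := by exact_mod_cast hn
  simp only [Function.comp]
  rw [← Real.log_div (by positivity) hn'.ne', add_div, div_self hn'.ne']

lemma tendsto_log_div_log_add_one :
    Tendsto (fun n : ℕ => Real.log n / Real.log (n + 1)) atTop (𝓝 1) := by
  have h1 : Tendsto (fun n : ℕ => Real.log (n + 1) - Real.log n) atTop (𝓝 0) := by
    have := tendsto_mul_sub_log_add_one.mul (tendsto_inv_atTop_zero.comp
      (tendsto_natCast_atTop_atTop (R := ℝ)))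
    rw [mul_zero] at this
    refine this.congr' ?_
    filter_upwards [eventually_gt_atTop 0] with n hn
    have hn' : (0 : ℝ) < n := by exact_mod_cast hn
    simp only [Function.comp]
    field_simp
  have h2 : Tendsto (fun n : ℕ => Real.log ((n : ℝ) + 1)) atTop atTop := by
    have := tendsto_log_natCast.comp (tendsto_add_atTop_nat 1)
    simpa [Function.comp_def] using this
  have h3 := (h1.div_atTop h2).const_sub 1
  rw [sub_zero] at h3
  refine h3.congr' ?_
  filter_upwards [h2.eventually_gt_atTop 0] with n hn
  field_simp
  ring

/-- Telescoping with D_n = 1/log n, because 1/log n - 1/log(n + 1) ~ 1/(n log² n). -/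
lemma tendsto_tail_mul_log {a : ℕ → ℝ} {l : ℝ}
    (ha : Tendsto (fun n : ℕ => a n * (n * Real.log n ^ 2)) atTop (𝓝 l)) :
    Summable a ∧ Tendsto (fun n : ℕ => (∑' j, a (n + j)) * Real.log n) atTop (𝓝 l) := by
  have hlt : ∀ᶠ j : ℕ in atTop, 0 < Real.log j ∧ Real.log j < Real.log ((j : ℝ) + 1) := by
    filter_upwards [tendsto_log_natCast.eventually_gt_atTop 0, eventually_gt_atTop 0] with j h1 h2
    have : (0 : ℝ) < j := by exact_mod_cast h2
    exact ⟨h1, Real.log_lt_log this (by linarith)⟩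
  have h := tendsto_tail_div_of_telescope (D := fun n : ℕ => (Real.log n)⁻¹) (a := a) (l := l)
    tendsto_log_natCast.inv_tendsto_atTop ?_ ?_
  · simpa [div_inv_eq_mul] using h
  · filter_upwards [hlt] with j hj
    push_cast
    exact inv_strictAnti₀ hj.1 hj.2
  · have h1 := ha.div (tendsto_mul_sub_log_add_one.mul tendsto_log_div_log_add_one) (by norm_num)
    rw [mul_one, div_one] at h1
    refine h1.congr' ?_
    filter_upwards [hlt, eventually_gt_atTop 0] with j hj h2
    have h3 : (0 : ℝ) < j := by exact_mod_cast h2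
    have h4 := sub_pos.2 hj.2
    have h5 := hj.1
    have h6 := hj.1.trans hj.2
    push_cast
    simp only [Pi.div_apply]
    rw [inv_sub_inv h5.ne' h6.ne']
    field_simp

lemma sum_range_two_pow (a : ℕ → ℝ) (K : ℕ) :
    ∑ j ∈ Finset.range (2 ^ K), a j = a 0 + ∑ k ∈ Finset.range K, dyadicSum a k := by
  induction K with
  | zero => simp
  | succ K ih =>
    rw [Finset.sum_range_succ, ← add_assoc, ← ih, dyadicSum, Finset.range_eq_Ico, Finset.range_eq_Ico,
      Finset.sum_Ico_consecutive _ (Nat.zero_le _) (Nat.pow_le_pow_right two_pos K.le_succ)]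

lemma tendsto_two_pow_nat : Tendsto (fun K : ℕ => 2 ^ K) atTop (atTop : Filter ℕ) :=
  tendsto_pow_atTop_atTop_of_one_lt one_lt_two

lemma GeometricDyadicSums.summable {a : ℕ → ℝ} (h : GeometricDyadicSums a) :
    Summable (dyadicSum a) := by
  obtain ⟨r, h0, h1, hr⟩ := h
  refine summable_of_isBigO_nat (summable_geometric_of_lt_one h0 h1) (IsBigO.of_bound 1 ?_)
  filter_upwards [hr] with k hk
  simpa [abs_of_nonneg h0] using hk

lemma GeometricDyadicSums.tendsto_tail {a : ℕ → ℝ} (h : GeometricDyadicSums a) :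
    Tendsto (fun K : ℕ => (∑' k, dyadicSum a (k + K)) * K) atTop (𝓝 0) := by
  obtain ⟨r, h0, h1, hr⟩ := h
  obtain ⟨N, hN⟩ := eventually_atTop.1 hr
  have h2 := (tendsto_self_mul_const_pow_of_lt_one h0 h1).mul_const (1 - r)⁻¹
  rw [zero_mul] at h2
  refine squeeze_zero_norm' ?_ h2
  filter_upwards [eventually_ge_atTop N] with K hK
  have hs : HasSum (fun k => r ^ (k + K)) (r ^ K * (1 - r)⁻¹) := by
    simpa [pow_add, mul_comm] using (hasSum_geometric_of_lt_one h0 h1).mul_left (r ^ K)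
  have := tsum_of_norm_bounded (f := fun k => dyadicSum a (k + K)) hs fun k => hN (k + K) (by omega)
  rw [norm_mul, Real.norm_natCast]
  calc _ ≤ (r ^ K * (1 - r)⁻¹) * K := by gcongr
    _ = _ := by ring

lemma GeometricDyadicSums.tendsto_sum {a : ℕ → ℝ} (h : GeometricDyadicSums a) :
    Tendsto (fun K => ∑ j ∈ Finset.range (2 ^ K), a j) atTop
      (𝓝 (a 0 + ∑' k, dyadicSum a k)) := by
  simp_rw [sum_range_two_pow]
  exact h.summable.hasSum.tendsto_sum_nat.const_add _

lemma GeometricDyadicSums.add {a b : ℕ → ℝ} (ha : GeometricDyadicSums a)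
    (hb : GeometricDyadicSums b) : GeometricDyadicSums fun j => a j + b j := by
  obtain ⟨r, h0, h1, hr⟩ := ha
  obtain ⟨s, h0', h1', hs⟩ := hb
  -- A ratio strictly above both rates absorbs the factor 2 from adding the two bounds.
  obtain ⟨t, ht, ht1⟩ := exists_between (max_lt h1 h1')
  have hmax : 0 ≤ max r s := h0.trans (le_max_left _ _)
  have ht0 : 0 < t := hmax.trans_lt ht
  refine ⟨t, ht0.le, ht1, ?_⟩
  have h2 : Tendsto (fun k : ℕ => 2 * (max r s / t) ^ k) atTop (𝓝 (2 * 0)) :=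
    (tendsto_pow_atTop_nhds_zero_of_lt_one (by positivity) ((div_lt_one ht0).2 ht)).const_mul 2
  rw [mul_zero] at h2
  filter_upwards [hr, hs, h2.eventually_lt_const one_pos] with k h3 h4 h5
  have h6 : dyadicSum (fun j => a j + b j) k = dyadicSum a k + dyadicSum b k :=
    Finset.sum_add_distrib
  have h7 : r ^ k ≤ max r s ^ k := pow_le_pow_left₀ h0 (le_max_left _ _) k
  have h8 : s ^ k ≤ max r s ^ k := pow_le_pow_left₀ h0' (le_max_right _ _) k
  rw [div_pow, ← mul_div_assoc, div_lt_one (by positivity)] at h5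
  rw [h6]
  linarith [abs_add_le (dyadicSum a k) (dyadicSum b k)]

lemma GeometricDyadicSums.congr {a b : ℕ → ℝ} (ha : GeometricDyadicSums a)
    (h : ∀ᶠ j in atTop, a j = b j) : GeometricDyadicSums b := by
  obtain ⟨r, h0, h1, hr⟩ := ha
  obtain ⟨N, hN⟩ := eventually_atTop.1 h
  refine ⟨r, h0, h1, ?_⟩
  filter_upwards [hr, tendsto_two_pow_nat.eventually_ge_atTop N] with k hk hkN
  have : dyadicSum b k = dyadicSum a k :=
    Finset.sum_congr rfl fun j hj => (hN j (hkN.trans (Finset.mem_Ico.1 hj).1)).symm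
  rwa [this]

/-- For 2^K ≤ n < 2^(K+1), both R n and log n lie between their values at the endpoints, and (K +
1)/K → 1. The factors 1 + 1/K and 1 - 1/(K + 1) below carry out this index change. -/
lemma tendsto_mul_log_of_two_pow {R : ℕ → ℝ} {l : ℝ} (hR : Antitone R) (hR0 : ∀ n, 0 ≤ R n)
    (h : Tendsto (fun K : ℕ => R (2 ^ K) * K) atTop (𝓝 l)) :
    Tendsto (fun n : ℕ => R n * Real.log n) atTop (𝓝 (l * Real.log 2)) := by
  have hlog : Tendsto (fun n => Nat.log 2 n) atTop atTop :=
    tendsto_atTop.2 fun K => by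
      filter_upwards [eventually_ge_atTop (2 ^ K)] with n hn
      exact Nat.le_log_of_pow_le one_lt_two hn
  have hcast := tendsto_natCast_atTop_atTop (R := ℝ)
  have hl2 : 0 < Real.log 2 := Real.log_pos one_lt_two
  have hup : Tendsto (fun K : ℕ => R (2 ^ K) * K * (1 + (K : ℝ)⁻¹) * Real.log 2) atTop
      (𝓝 (l * Real.log 2)) := by
    have := (h.mul ((tendsto_inv_atTop_zero.comp hcast).const_add 1)).mul_const (Real.log 2)
    simpa using this
  have hlow : Tendsto (fun K : ℕ => R (2 ^ (K + 1)) * (K + 1 : ℕ) * (1 - ((K + 1 : ℕ) : ℝ)⁻¹) *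
      Real.log 2) atTop (𝓝 (l * Real.log 2)) := by
    have := (((h.mul ((tendsto_inv_atTop_zero.comp hcast).const_sub 1)).mul_const (Real.log 2)).comp
      (tendsto_add_atTop_nat 1))
    simpa [Function.comp_def] using this
  refine tendsto_of_tendsto_of_tendsto_of_le_of_le' (hlow.comp hlog) (hup.comp hlog) ?_ ?_
  · filter_upwards [eventually_gt_atTop 0] with n hn
    simp only [Function.comp]
    have h1 : (2 : ℝ) ^ Nat.log 2 n ≤ n := by exact_mod_cast Nat.pow_log_le_self 2 hn.ne'
    have h2 : (Nat.log 2 n : ℝ) * Real.log 2 ≤ Real.log n := by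
      rw [← Real.log_pow]; exact Real.log_le_log (by positivity) h1
    have h3 : R (2 ^ (Nat.log 2 n + 1)) ≤ R n := hR (Nat.lt_pow_succ_log_self one_lt_two n).le
    calc _ = R (2 ^ (Nat.log 2 n + 1)) * (Nat.log 2 n * Real.log 2) := by
          push_cast
          field_simp
          ring
      _ ≤ _ := mul_le_mul h3 h2 (by positivity) (hR0 n)
  · filter_upwards [hlog.eventually_gt_atTop 0, eventually_gt_atTop 0] with n hn hn0
    simp only [Function.comp]
    have h1 : (n : ℝ) ≤ 2 ^ (Nat.log 2 n + 1) := by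
      exact_mod_cast (Nat.lt_pow_succ_log_self one_lt_two n).le
    have h2 : Real.log n ≤ (Nat.log 2 n + 1 : ℕ) * Real.log 2 := by
      rw [← Real.log_pow]; exact Real.log_le_log (by exact_mod_cast hn0) h1
    have h3 : R n ≤ R (2 ^ Nat.log 2 n) := hR (Nat.pow_log_le_self 2 hn0.ne')
    have hn' : (0 : ℝ) < Nat.log 2 n := by exact_mod_cast hn
    calc _ ≤ R (2 ^ Nat.log 2 n) * ((Nat.log 2 n + 1 : ℕ) * Real.log 2) :=
          mul_le_mul h3 h2 (Real.log_natCast_nonneg n) (hR0 _)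
      _ = _ := by
          push_cast
          field_simp

/-- A nonnegative sequence whose dyadic block sums are geometrically close to those of a sequence
equivalent to `l / (n * log n ^ 2)` is summable with tails equivalent to `l / log n`. -/
lemma summable_and_tendsto_tail_mul_log {w a : ℕ → ℝ} {l : ℝ} (hw : ∀ j, 0 ≤ w j)
    (ha : Tendsto (fun n : ℕ => a n * (n * Real.log n ^ 2)) atTop (𝓝 l))
    (he : GeometricDyadicSums fun j => w j - a j) :
    Summable w ∧ Tendsto (fun n : ℕ => (∑' j, w (n + j)) * Real.log n) atTop (𝓝 l) := by
  obtain ⟨hsa, hta⟩ := tendsto_tail_mul_log ha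
  have hlim := he.tendsto_sum.add (hsa.hasSum.tendsto_sum_nat.comp tendsto_two_pow_nat)
  simp only [Function.comp_def, ← Finset.sum_add_distrib, sub_add_cancel] at hlim
  have hmono : Monotone fun n => ∑ j ∈ Finset.range n, w j := fun n m hnm =>
    Finset.sum_le_sum_of_subset_of_nonneg (Finset.range_mono hnm) fun j _ _ => hw j
  -- Convergence of the partial sums along powers of two bounds all of them, by nonnegativity and n
  -- < 2^n.
  have hsw : Summable w := by
    have hbd := fun n => (hmono (Nat.lt_two_pow_self (n := n)).le).trans
      (Monotone.ge_of_tendsto (hmono.comp fun i j hij => Nat.pow_le_pow_right two_pos hij) hlim n)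
    exact summable_of_sum_range_le hw hbd
  refine ⟨hsw, ?_⟩
  have hse := hsw.sub hsa
  -- The total of w - a is computed termwise and by blocks; removing the common part below 2^K
  -- leaves equal tails.
  have htail : ∀ K, ∑' j, w (2 ^ K + j) =
      (∑' j, a (2 ^ K + j)) + ∑' k, dyadicSum (fun j => w j - a j) (k + K) := fun K => by
    have h1 := hse.sum_add_tsum_nat_add (2 ^ K)
    have h2 := he.summable.sum_add_tsum_nat_add K
    have h3 := tendsto_nhds_unique he.tendsto_sum
      (hse.hasSum.tendsto_sum_nat.comp tendsto_two_pow_nat)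
    rw [sum_range_two_pow] at h1
    have h4 := ((summable_nat_add_iff (2 ^ K)).2 hsw).tsum_sub
      ((summable_nat_add_iff (2 ^ K)).2 hsa)
    simp_rw [add_comm (2 ^ K)]
    linarith
  have hl2 : 0 < Real.log 2 := Real.log_pos one_lt_two
  have hanti : Antitone fun n => ∑' j, w (n + j) := by
    have : ∀ n, ∑' j, w (n + j) = ∑' j, w j - ∑ j ∈ Finset.range n, w j := fun n => by
      rw [← hsw.sum_add_tsum_nat_add n]
      simp [add_comm]
    intro n m hnm
    simp only [this]
    linarith [hmono hnm]
  have h1 := tendsto_mul_log_of_two_pow hanti (fun n => tsum_nonneg fun j => hw _)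
    (l := l / Real.log 2) ?_
  · rwa [div_mul_cancel₀ _ hl2.ne'] at h1
  · have h2 := ((hta.comp tendsto_two_pow_nat).div_const (Real.log 2)).add he.tendsto_tail
    rw [add_zero] at h2
    refine h2.congr fun K => ?_
    rw [htail]
    simp only [Function.comp]
    push_cast
    rw [Real.log_pow]
    field_simp

/-! ### The Laplace exponent ψ and its inverse -/

lemma mStLaplaceExponent_one_zero (t : ℝ) :
    mStLaplaceExponent 1 0 t = ∫ s in (0 : ℝ)..1, t ^ s := by
  simp [mStLaplaceExponent, stableLaplaceExponent]

lemma ae_pos_and_le_one : ∀ᵐ s : ℝ, s ∈ uIoc (0 : ℝ) 1 → 0 < s ∧ s ≤ 1 :=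
  ae_of_all _ fun s hs => by rwa [uIoc_of_le zero_le_one] at hs

lemma rpow_le_max_one {z s : ℝ} (hz : 0 ≤ z) (hs : 0 < s ∧ s ≤ 1) : z ^ s ≤ max 1 z := by
  rcases le_total z 1 with h | h
  · exact (Real.rpow_le_one hz h hs.1.le).trans (le_max_left _ _)
  · exact (Real.rpow_le_self_of_one_le h hs.2).trans (le_max_right _ _)

lemma mStLaplaceExponent_zero : mStLaplaceExponent 1 0 0 = 0 := by
  rw [mStLaplaceExponent_one_zero]
  refine intervalIntegral.integral_zero_ae ?_
  filter_upwards [ae_pos_and_le_one] with s hs h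
  exact Real.zero_rpow (hs h).1.ne'

lemma mStLaplaceExponent_nonneg {z : ℝ} (hz : 0 ≤ z) : 0 ≤ mStLaplaceExponent 1 0 z := by
  rw [mStLaplaceExponent_one_zero]
  exact intervalIntegral.integral_nonneg zero_le_one fun s _ => Real.rpow_nonneg hz s

lemma mStLaplaceExponent_le_max {z : ℝ} (hz : 0 ≤ z) : mStLaplaceExponent 1 0 z ≤ max 1 z := by
  rw [mStLaplaceExponent_one_zero]
  have h := intervalIntegral.norm_integral_le_of_norm_le_const (a := (0 : ℝ)) (b := 1)
    (f := fun s => z ^ s) (C := max 1 z) fun s hs => by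
      rw [uIoc_of_le zero_le_one] at hs
      rw [Real.norm_of_nonneg (Real.rpow_nonneg hz s)]
      exact rpow_le_max_one hz hs
  simpa using (le_abs_self _).trans h

lemma mStLaplaceExponent_eq_div_log {z : ℝ} (hz : 1 < z) :
    mStLaplaceExponent 1 0 z = (z - 1) / Real.log z := by
  have hz0 : 0 < z := by linarith
  have hl : Real.log z ≠ 0 := (Real.log_pos hz).ne'
  rw [mStLaplaceExponent_one_zero, intervalIntegral.integral_eq_sub_of_hasDerivAt
    (f := fun s => z ^ s / Real.log z)]
  · simp [sub_div]
  · intro s _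
    have := (Real.hasStrictDerivAt_const_rpow hz0 s).hasDerivAt.div_const (Real.log z)
    rwa [mul_div_cancel_right₀ _ hl] at this
  · exact (Real.continuous_const_rpow hz0.ne').intervalIntegrable _ _

lemma continuousOn_mStLaplaceExponent (M : ℝ) :
    ContinuousOn (mStLaplaceExponent 1 0) (Icc 0 M) := by
  rw [show mStLaplaceExponent 1 0 = fun t => ∫ s in (0 : ℝ)..1, t ^ s from
    funext mStLaplaceExponent_one_zero]
  intro z hz
  refine intervalIntegral.continuousWithinAt_of_dominated_interval (bound := fun _ => max 1 M)
    (Eventually.of_forall fun x => by fun_prop) ?_ intervalIntegrable_const ?_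
  · filter_upwards [self_mem_nhdsWithin] with x hx
    filter_upwards [ae_pos_and_le_one] with s hs h
    rw [Real.norm_of_nonneg (Real.rpow_nonneg hx.1 s)]
    exact (rpow_le_max_one hx.1 (hs h)).trans (max_le_max le_rfl hx.2)
  · filter_upwards [ae_pos_and_le_one] with s hs h
    exact (Real.continuous_rpow_const (hs h).1.le).continuousWithinAt

lemma exists_le_mStLaplaceExponent (y : ℝ) : ∃ M, 0 ≤ M ∧ y ≤ mStLaplaceExponent 1 0 M := by
  -- With u = max y 1, ψ(e^(2u)) = (e^(2u) - 1)/(2u) ≥ 1 + u, from e^x ≥ 1 + x + x²/2.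
  refine ⟨Real.exp (max y 1 * 2), (Real.exp_pos _).le, ?_⟩
  have h1 : 1 ≤ max y 1 := le_max_right _ _
  have h2 := le_max_left y 1
  rw [mStLaplaceExponent_eq_div_log (Real.one_lt_exp_iff.2 (by linarith)), Real.log_exp,
    le_div_iff₀ (by linarith)]
  have h3 := Real.quadratic_le_exp_of_nonneg (x := max y 1 * 2) (by linarith)
  nlinarith

/-- The intermediate value theorem supplies a preimage; injectivity of ψ plays no role, since any
choice of preimage serves. -/
lemma mStLaplaceExponentInv_spec {y : ℝ} (hy : 0 ≤ y) :
    0 ≤ mStLaplaceExponentInv 1 0 y ∧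
      mStLaplaceExponent 1 0 (mStLaplaceExponentInv 1 0 y) = y := by
  obtain ⟨M, hM, hyM⟩ := exists_le_mStLaplaceExponent y
  have h : ∃ a ∈ Ici (0 : ℝ), mStLaplaceExponent 1 0 a = y := by
    obtain ⟨a, ha, h⟩ := intermediate_value_Icc hM (continuousOn_mStLaplaceExponent M)
      ⟨mStLaplaceExponent_zero.le.trans hy, hyM⟩
    exact ⟨a, ha.1, h⟩
  exact Function.invFunOn_pos h

/-- This turns linear growth of ψ(Z_j) into a linear lower bound on Z_j, which is all that the
variance estimates need. -/
lemma le_of_one_lt_mStLaplaceExponent {z : ℝ} (hz : 0 ≤ z) (h : 1 < mStLaplaceExponent 1 0 z) :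
    mStLaplaceExponent 1 0 z ≤ z := by
  rcases le_max_iff.1 (mStLaplaceExponent_le_max hz) with h1 | h1
  · linarith
  · exact h1

/-! ### Asymptotics of the conditional mean -/

lemma integral_mul_rpow {z : ℝ} (hz : 1 < z) :
    ∫ s in (0 : ℝ)..1, s * z ^ s = (z * (Real.log z - 1) + 1) / Real.log z ^ 2 := by
  have hz0 : 0 < z := by linarith
  have hl : Real.log z ≠ 0 := (Real.log_pos hz).ne'
  rw [intervalIntegral.integral_eq_sub_of_hasDerivAt
    (f := fun s => z ^ s * (s / Real.log z - 1 / Real.log z ^ 2))]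
  · simp
    field_simp
  · intro s _
    have h1 := (Real.hasStrictDerivAt_const_rpow hz0 s).hasDerivAt
    have h2 := ((hasDerivAt_id s).div_const (Real.log z)).sub_const (1 / Real.log z ^ 2)
    refine (h1.mul h2).congr_deriv ?_
    simp only [id]
    field_simp
    ring
  · exact (continuous_mul_rpow hz0).intervalIntegrable _ _

lemma integral_mul_rpow_mul_one_sub {z : ℝ} (hz : 1 < z) :
    ∫ s in (0 : ℝ)..1, s * z ^ s * (1 - s) =
      (z * (Real.log z - 2) + (Real.log z + 2)) / Real.log z ^ 3 := by
  have hz0 : 0 < z := by linarith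
  have hl : Real.log z ≠ 0 := (Real.log_pos hz).ne'
  rw [intervalIntegral.integral_eq_sub_of_hasDerivAt
    (f := fun s => z ^ s * (-(s ^ 2) / Real.log z + s * (1 / Real.log z + 2 / Real.log z ^ 2) -
      (1 / Real.log z ^ 2 + 2 / Real.log z ^ 3)))]
  · simp
    field_simp
    ring
  · intro s _
    have h1 := (Real.hasStrictDerivAt_const_rpow hz0 s).hasDerivAt
    have h2 := ((((hasDerivAt_id s).pow 2).neg.div_const (Real.log z)).add
      ((hasDerivAt_id s).mul_const (1 / Real.log z + 2 / Real.log z ^ 2))).sub_const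
        (1 / Real.log z ^ 2 + 2 / Real.log z ^ 3)
    refine (h1.mul h2).congr_deriv ?_
    simp
    field_simp
    ring
  · exact ((continuous_mul_rpow hz0).mul (by fun_prop)).intervalIntegrable _ _

/-- The conditional mean of `W'` given `T + β = z`. -/
noncomputable def weightMean (z : ℝ) : ℝ := (∫ s, (1 - s) ∂mixingKernel z) / z

lemma measurable_weightMean : Measurable weightMean := by
  have h : Measurable fun z => ∫ s, (1 - s) ∂mixingKernel z :=
    (StronglyMeasurable.integral_kernel_prod_right' (κ := mixingKernel)
      (f := fun p : ℝ × ℝ => 1 - p.2) (by fun_prop)).measurable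
  exact h.div measurable_id

lemma tendsto_weightMean : Tendsto (fun z => weightMean z * (z * Real.log z)) atTop (𝓝 1) := by
  have hL := Real.tendsto_log_atTop.inv_tendsto_atTop
  have hz : Tendsto (fun z : ℝ => z⁻¹) atTop (𝓝 0) := tendsto_inv_atTop_zero
  -- The exact quotient of the two integrals, with numerator and denominator divided by z log z.
  have h1 : Tendsto (fun z : ℝ => (1 - 2 * (Real.log z)⁻¹ + z⁻¹ + 2 * z⁻¹ * (Real.log z)⁻¹) /
      (1 - (Real.log z)⁻¹ + z⁻¹ * (Real.log z)⁻¹)) atTop (𝓝 1) := by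
    have := ((((hL.const_mul 2).const_sub 1).add hz).add ((hz.const_mul 2).mul hL)).div
      ((hL.const_sub 1).add (hz.mul hL)) (by norm_num)
    simpa [Pi.div_def] using this
  refine h1.congr' ?_
  filter_upwards [eventually_gt_atTop 1] with z hz1
  have hz0 : 0 < z := by linarith
  have hl : 0 < Real.log z := Real.log_pos hz1
  have hpos := integral_mul_rpow_pos hz0
  rw [weightMean, mixingKernel_apply, clampPos_of_pos hz0, integral_mixingLaw hz0,
    integral_mul_rpow_mul_one_sub hz1]
  rw [integral_mul_rpow hz1] at hpos ⊢
  have hn : z * (Real.log z - 1) + 1 ≠ 0 := fun h => by simp [h] at hpos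
  have hn' : 1 - (Real.log z)⁻¹ + z⁻¹ * (Real.log z)⁻¹ =
    (z * (Real.log z - 1) + 1) / (z * Real.log z) := by
    field_simp
  rw [hn']
  field_simp
  ring

lemma tendsto_log_div_log_sub_one_div_log :
    Tendsto (fun z => Real.log ((z - 1) / Real.log z) / Real.log z) atTop (𝓝 1) := by
  have hL := Real.tendsto_log_atTop
  have h1 : Tendsto (fun z : ℝ => Real.log (1 - z⁻¹)) atTop (𝓝 0) := by
    have := (tendsto_inv_atTop_zero (𝕜 := ℝ)).const_sub 1
    rw [sub_zero] at this
    simpa using this.log one_ne_zero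
  have h2 : Tendsto (fun z : ℝ => Real.log (Real.log z) / Real.log z) atTop (𝓝 0) :=
    (Real.isLittleO_log_id_atTop.tendsto_div_nhds_zero).comp hL
  have h3 := ((h1.div_atTop hL).sub h2).const_add 1
  simp only [sub_zero, add_zero] at h3
  refine h3.congr' ?_
  filter_upwards [eventually_gt_atTop 1] with z hz
  have hz0 : 0 < z := by linarith
  have hl : 0 < Real.log z := Real.log_pos hz
  have hi : 0 < 1 - z⁻¹ := sub_pos.2 (inv_lt_one_of_one_lt₀ hz)
  have : z - 1 = z * (1 - z⁻¹) := by field_simp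
  rw [this, Real.log_div (by positivity) hl.ne', Real.log_mul hz0.ne' hi.ne']
  field_simp
  ring

lemma tendsto_weightMean_mul {Y Z : ℕ → ℝ} {η : ℝ} (hη : 0 < η)
    (hY : Tendsto (fun n : ℕ => Y n / n) atTop (𝓝 (1 / η)))
    (hZ : ∀ n, 0 ≤ Z n) (hZY : ∀ n, mStLaplaceExponent 1 0 (Z n) = Y n) :
    (∀ᶠ n in atTop, Y n ≤ Z n) ∧
      Tendsto (fun n : ℕ => weightMean (Z n) * (n * Real.log n ^ 2)) atTop (𝓝 η) := by
  have hcast := tendsto_natCast_atTop_atTop (R := ℝ)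
  have hev : ∀ᶠ n : ℕ in atTop, (0 : ℝ) < n := hcast.eventually_gt_atTop 0
  have hYtop : Tendsto Y atTop atTop := by
    refine (hY.pos_mul_atTop (by positivity) hcast).congr' ?_
    filter_upwards [hev] with n hn
    field_simp
  have hle : ∀ᶠ n in atTop, Y n ≤ Z n := by
    filter_upwards [hYtop.eventually_gt_atTop 1] with n hn
    rw [← hZY n] at hn ⊢
    exact le_of_one_lt_mStLaplaceExponent (hZ n) hn
  have hZtop : Tendsto Z atTop atTop := tendsto_atTop_mono' _ hle hYtop
  refine ⟨hle, ?_⟩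
  have h1 : Tendsto (fun n : ℕ => Real.log (Y n) / Real.log n) atTop (𝓝 1) := by
    have h2 : Tendsto (fun n : ℕ => Real.log (Y n / n)) atTop (𝓝 (Real.log (1 / η))) :=
      hY.log (by positivity)
    have h3 := (h2.div_atTop tendsto_log_natCast).const_add 1
    rw [add_zero] at h3
    refine h3.congr' ?_
    filter_upwards [hev, hYtop.eventually_gt_atTop 0,
      tendsto_log_natCast.eventually_gt_atTop 0] with n hn hn2 hn3
    rw [Real.log_div hn2.ne' hn.ne']
    field_simp
    ring
  have hYZ : ∀ᶠ n in atTop, Y n = (Z n - 1) / Real.log (Z n) := by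
    filter_upwards [hZtop.eventually_gt_atTop 1] with n hn
    rw [← hZY n, mStLaplaceExponent_eq_div_log hn]
  have h2 : Tendsto (fun n : ℕ => Real.log (Y n) / Real.log (Z n)) atTop (𝓝 1) := by
    refine (tendsto_log_div_log_sub_one_div_log.comp hZtop).congr' ?_
    filter_upwards [hYZ] with n hn
    rw [Function.comp_apply, hn]
  have h3 : Tendsto (fun n => 1 - (Z n)⁻¹) atTop (𝓝 1) := by
    simpa using hZtop.inv_tendsto_atTop.const_sub 1
  -- The factors are m(Z) Z log Z, n/Y, (Z - 1)/Z = Y log Z / Z and (log n / log Z)²; their product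
  -- is m(Z) n log² n.
  have h4 := (((tendsto_weightMean.comp hZtop).mul (hY.inv₀ (by positivity))).mul h3).mul
    ((h2.div h1 one_ne_zero).pow 2)
  simp only [one_div, inv_inv, one_mul, mul_one, one_pow, div_self one_ne_zero] at h4
  refine h4.congr' ?_
  filter_upwards [hYZ, hev, hZtop.eventually_gt_atTop 1, hYtop.eventually_gt_atTop 1,
    tendsto_log_natCast.eventually_gt_atTop 0] with n h5 h6 h7 h8 h9
  have h10 : 0 < Real.log (Z n) := Real.log_pos h7
  have h11 : 0 < Real.log (Y n) := Real.log_pos h8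
  have h12 : 0 < Z n := by linarith
  have h13 : Z n - 1 = Y n * Real.log (Z n) := by rw [h5]; field_simp
  have h14 : 1 - (Z n)⁻¹ = Y n * Real.log (Z n) / Z n := by rw [← h13]; field_simp
  simp only [Function.comp, Pi.div_apply, h14]
  field_simp

/-! ### Poisson arrivals and the strong law -/

lemma integral_id_expMeasure : ∫ x, x ∂expMeasure 1 = 1 := by
  rw [expMeasure, integral_id_gammaMeasure one_pos one_pos, div_one]

lemma sum_gaps {Ω : Type*} (ξ : ℕ → Ω → ℝ) (n : ℕ) (ω : Ω) :
    ∑ i ∈ Finset.range (n + 1), gaps ξ i ω = ξ n ω := by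
  induction n with
  | zero => simp [gaps]
  | succ n ih => rw [Finset.sum_range_succ, ih]; simp [gaps]

section Arrivals

variable {Ω : Type*} [MeasurableSpace Ω] {P : Measure Ω}

lemma measurable_gaps {ξ : ℕ → Ω → ℝ} (h : ∀ j, Measurable (ξ j)) : ∀ j, Measurable (gaps ξ j)
  | 0 => h 0
  | j + 1 => (h (j + 1)).sub (h j)

lemma ae_arrivals_pos {ξ : ℕ → Ω → ℝ} (h : ∀ j, Measurable (ξ j))
    (hlaw : ∀ j, P.map (gaps ξ j) = expMeasure 1) : ∀ᵐ ω ∂P, ∀ n, 0 < ξ n ω := by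
  have h1 : ∀ᵐ ω ∂P, ∀ j, 0 < gaps ξ j ω := ae_all_iff.2 fun j => by
    refine ae_of_ae_map (p := fun x => 0 < x) (measurable_gaps h j).aemeasurable ?_
    rw [hlaw]
    exact ae_pos_gammaMeasure _ _
  filter_upwards [h1] with ω hω n
  rw [← sum_gaps ξ n ω]
  exact Finset.sum_pos (fun j _ => hω j) ⟨0, by simp⟩

lemma ae_tendsto_arrivals_div {ξ : ℕ → Ω → ℝ} (h : ∀ j, Measurable (ξ j))
    (hind : iIndepFun (gaps ξ) P) (hlaw : ∀ j, P.map (gaps ξ j) = expMeasure 1) :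
    ∀ᵐ ω ∂P, Tendsto (fun n : ℕ => ξ n ω / n) atTop (𝓝 1) := by
  have hm := measurable_gaps h
  have hint : Integrable (gaps ξ 0) P := by
    have := integrable_id_gammaMeasure (a := 1) (r := 1) one_pos one_pos
    rw [← expMeasure, ← hlaw 0] at this
    exact (integrable_map_measure (by fun_prop) (hm 0).aemeasurable).1 this
  have hE : ∫ ω, gaps ξ 0 ω ∂P = 1 := by
    rw [← integral_id_expMeasure, ← hlaw 0, integral_map (hm 0).aemeasurable (by fun_prop)]
  have hs := strong_law_ae_real (gaps ξ) hint (fun i j hij => hind.indepFun hij)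
    fun i => ⟨(hm i).aemeasurable, (hm 0).aemeasurable, by rw [hlaw, hlaw]⟩
  filter_upwards [hs] with ω hω
  rw [hE] at hω
  -- `ξ n` is a sum of n + 1 gaps, so the strong law controls ξ n / (n + 1); the factor 1 + 1/n
  -- corrects the denominator.
  have h1 := hω.comp (tendsto_add_atTop_nat 1)
  have h2 : Tendsto (fun n : ℕ => 1 + (n : ℝ)⁻¹) atTop (𝓝 1) := by
    simpa using (tendsto_inv_atTop_zero.comp (tendsto_natCast_atTop_atTop (R := ℝ))).const_add 1
  have h3 := h1.mul h2
  rw [one_mul] at h3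
  refine h3.congr' ?_
  filter_upwards [eventually_gt_atTop 0] with n hn
  have : (0 : ℝ) < n := by exact_mod_cast hn
  simp only [Function.comp, sum_gaps]
  push_cast
  field_simp

end Arrivals

/-! ### The two centred fluctuations and their second moments -/

lemma ae_mem_Ioo_mixingKernel (z : ℝ) : ∀ᵐ s ∂mixingKernel z, s ∈ Ioo (0 : ℝ) 1 :=
  ae_mem_Ioo_mixingLaw _

lemma integrable_one_sub_mixingKernel (z : ℝ) : Integrable (fun s => 1 - s) (mixingKernel z) := by
  refine Integrable.of_bound (by fun_prop) 1 ?_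
  filter_upwards [ae_mem_Ioo_mixingKernel z] with s hs
  rw [Real.norm_eq_abs, abs_le]
  constructor <;> linarith [hs.1, hs.2]

lemma weightMean_mem_Icc {z : ℝ} (hz : 0 < z) : weightMean z ∈ Icc 0 (1 / z) := by
  have h0 : 0 ≤ ∫ s, (1 - s) ∂mixingKernel z := integral_nonneg_of_ae (by
    filter_upwards [ae_mem_Ioo_mixingKernel z] with s hs using sub_nonneg.2 hs.2.le)
  have h1 : ∫ s, (1 - s) ∂mixingKernel z ≤ ∫ _, (1 : ℝ) ∂mixingKernel z :=
    integral_mono_ae (integrable_one_sub_mixingKernel z) (integrable_const _) (by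
      filter_upwards [ae_mem_Ioo_mixingKernel z] with s hs
      linarith [hs.1])
  rw [integral_const, probReal_univ, one_smul] at h1
  exact ⟨div_nonneg h0 hz.le, div_le_div_of_nonneg_right h1 hz.le⟩

/-- The fluctuation of the conditional mean of `W'` due to `S`, cut off where `z = T + β` is below
`b`. -/
noncomputable def mixingFluctuation (b : ℝ) (p : ℝ × ℝ) : ℝ :=
  if b ≤ p.1 then (1 - p.2) / p.1 - weightMean p.1 else 0

/-- The fluctuation of `W'` about its conditional mean given `S = s` and `T + β = z`, cut off where
`z` is below `b`. -/
noncomputable def gammaFluctuation (b : ℝ) (p : (ℝ × ℝ) × ℝ) : ℝ :=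
  if b ≤ p.1.2 ∧ p.1.1 < 1 ∧ 0 < p.1.1 then p.2 - (1 - p.1.1) / p.1.2 else 0

lemma measurable_mixingFluctuation (b : ℝ) : Measurable (mixingFluctuation b) := by
  have := measurable_weightMean
  exact Measurable.ite (measurableSet_le measurable_const measurable_fst) (by fun_prop)
    measurable_const

lemma measurable_gammaFluctuation (b : ℝ) : Measurable (gammaFluctuation b) := by
  refine Measurable.ite ?_ (by fun_prop) measurable_const
  exact (measurableSet_le measurable_const (measurable_snd.comp measurable_fst)).inter
    ((measurableSet_lt (measurable_fst.comp measurable_fst) measurable_const).inter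
      (measurableSet_lt measurable_const (measurable_fst.comp measurable_fst)))

lemma integral_mixingFluctuation (b z : ℝ) :
    ∫ s, mixingFluctuation b (z, s) ∂mixingKernel z = 0 := by
  simp only [mixingFluctuation]
  split_ifs
  · rw [integral_sub ((integrable_one_sub_mixingKernel z).div_const z) (integrable_const _),
      integral_div, integral_const, probReal_univ, one_smul, weightMean, sub_self]
  · simp

/-- Above the cutoff, (1 - s)/z and its mean both lie in [0, 1/z]. The constant 3 merely matches the
gamma bound. -/
lemma lintegral_sq_mixingFluctuation_le {b : ℝ} (hb : 0 < b) (z : ℝ) :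
    ∫⁻ s, ENNReal.ofReal (mixingFluctuation b (z, s) ^ 2) ∂mixingKernel z ≤
      ENNReal.ofReal (3 / b ^ 2) := by
  have h : ∀ᵐ s ∂mixingKernel z, ENNReal.ofReal (mixingFluctuation b (z, s) ^ 2) ≤
      ENNReal.ofReal (3 / b ^ 2) := by
    filter_upwards [ae_mem_Ioo_mixingKernel z] with s hs
    refine ENNReal.ofReal_le_ofReal ?_
    unfold mixingFluctuation
    split_ifs with h
    · have h : b ≤ z := h
      have hz : 0 < z := hb.trans_le h
      have h1 := weightMean_mem_Icc hz
      have h2 : 0 ≤ (1 - s) / z := div_nonneg (sub_nonneg.2 hs.2.le) hz.le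
      have h3 : (1 - s) / z ≤ 1 / z := div_le_div_of_nonneg_right (by linarith [hs.1]) hz.le
      calc ((1 - s) / z - weightMean z) ^ 2 ≤ (1 / z) ^ 2 :=
            sq_le_sq' (by linarith [h1.2]) (by linarith [h1.1])
        _ ≤ (1 / b) ^ 2 := by gcongr
        _ = 1 / b ^ 2 := by ring
        _ ≤ _ := by gcongr; norm_num
    · rw [zero_pow two_ne_zero]
      positivity
  refine (lintegral_mono_ae h).trans ?_
  simp

lemma integral_gammaFluctuation {b : ℝ} (hb : 0 < b) (p : ℝ × ℝ) :
    ∫ x, gammaFluctuation b (p, x) ∂gammaKernel p = 0 := by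
  simp only [gammaFluctuation]
  split_ifs with h
  · have h1 : 0 < p.2 := hb.trans_le h.1
    have h2 : 0 < 1 - p.1 := sub_pos.2 h.2.1
    have h3 : IsProbabilityMeasure (gammaMeasure (1 - p.1) p.2) :=
      isProbabilityMeasure_gammaMeasure h2 h1
    rw [gammaKernel_apply, clampPos_of_pos h1, clampPos_of_pos h2,
      integral_sub (integrable_id_gammaMeasure h2 h1) (integrable_const _),
      integral_id_gammaMeasure h2 h1, integral_const, probReal_univ, one_smul, sub_self]
  · simp

/-- For nonnegative x and mean μ, (x - μ)² ≤ x² + μ². With shape a < 1, the numerator a(a + 1) + a²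
is at most 3. -/
lemma lintegral_sq_gammaFluctuation_le {b : ℝ} (hb : 0 < b) (p : ℝ × ℝ) :
    ∫⁻ x, ENNReal.ofReal (gammaFluctuation b (p, x) ^ 2) ∂gammaKernel p ≤
      ENNReal.ofReal (3 / b ^ 2) := by
  simp only [gammaFluctuation]
  split_ifs with h
  · have h0 : b ≤ p.2 := h.1
    have h1 : 0 < p.2 := hb.trans_le h.1
    have h2 : 0 < 1 - p.1 := sub_pos.2 h.2.1
    have h3 : IsProbabilityMeasure (gammaMeasure (1 - p.1) p.2) :=
      isProbabilityMeasure_gammaMeasure h2 h1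
    have h4 : 1 - p.1 < 1 := by linarith [h.2.2]
    rw [gammaKernel_apply, clampPos_of_pos h1, clampPos_of_pos h2]
    set a := 1 - p.1
    have hle : ∀ᵐ x ∂gammaMeasure a p.2, ENNReal.ofReal ((x - a / p.2) ^ 2) ≤
        ENNReal.ofReal (x ^ 2) + ENNReal.ofReal ((a / p.2) ^ 2) := by
      filter_upwards [ae_nonneg_gammaMeasure a p.2] with x hx
      rw [← ENNReal.ofReal_add (by positivity) (by positivity)]
      refine ENNReal.ofReal_le_ofReal ?_
      have : 0 ≤ x * (a / p.2) := by positivity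
      nlinarith
    refine (lintegral_mono_ae hle).trans ?_
    rw [lintegral_add_left (by fun_prop), lintegral_ofReal_sq_gammaMeasure h2 h1, lintegral_const,
      measure_univ, mul_one, ← ENNReal.ofReal_add (by positivity) (by positivity)]
    refine ENNReal.ofReal_le_ofReal ?_
    calc _ = (a * (a + 1) + a ^ 2) / p.2 ^ 2 := by ring
      _ ≤ 3 / p.2 ^ 2 := by gcongr; nlinarith
      _ ≤ _ := by gcongr
  · simp

/-! ### Application to the size-biased sample -/

lemma measurable_sigmaOf {Ω : Type*} (X : ℕ → Ω → ℝ) (j : ℕ) : Measurable[sigmaOf X] (X j) :=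
  (comap_measurable (X j)).mono (le_iSup (fun j => MeasurableSpace.comap (X j) inferInstance) j)
    le_rfl

lemma measurable_sigmaOf_sup {Ω : Type*} (T S : ℕ → Ω → ℝ) (β : ℝ) (j : ℕ) :
    Measurable[sigmaOf T ⊔ sigmaOf S] fun ω => (S j ω, T j ω + β) :=
  ((measurable_sigmaOf S j).mono le_sup_right le_rfl).prodMk
    (((measurable_sigmaOf T j).mono le_sup_left le_rfl).add_const β)

section SizeBiased

variable {Ω : Type*} [MeasurableSpace Ω] {P : Measure Ω}
  {β c η : ℝ} {ξ T S W' W : ℕ → Ω → ℝ}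

lemma IsSizeBiasedSample.rate_spec (hW : IsSizeBiasedSample P 1 0 β c η ξ T S W' W)
    (hβ : 0 ≤ β) (hη : 0 < η) {ω : Ω} (hω : ∀ n, 0 < ξ n ω) (n : ℕ) :
    0 < T n ω + β ∧
      mStLaplaceExponent 1 0 (T n ω + β) = ξ n ω / η + mStLaplaceExponent 1 0 β := by
  have h1 := mStLaplaceExponent_nonneg hβ
  have h2 : 0 < ξ n ω / η + mStLaplaceExponent 1 0 β := by
    have := hω n
    positivity
  obtain ⟨h3, h4⟩ := mStLaplaceExponentInv_spec h2.le
  rw [hW.T_eq, sub_add_cancel]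
  -- The rate cannot vanish, since ψ(0) = 0 while the prescribed value is positive.
  refine ⟨h3.lt_of_ne fun h => ?_, h4⟩
  rw [← h, mStLaplaceExponent_zero] at h4
  exact h2.ne h4

lemma sigmaOf_le {X : ℕ → Ω → ℝ} (h : ∀ j, Measurable (X j)) : sigmaOf X ≤ ‹MeasurableSpace Ω› :=
  iSup_le fun j => (h j).comap_le

lemma IsSizeBiasedSample.sigmaOf_sup_le (hW : IsSizeBiasedSample P 1 0 β c η ξ T S W' W) :
    sigmaOf T ⊔ sigmaOf S ≤ ‹MeasurableSpace Ω› :=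
  sup_le (sigmaOf_le hW.measurable_T) (sigmaOf_le hW.measurable_S)

lemma IsSizeBiasedSample.ae_rate_pos (hW : IsSizeBiasedSample P 1 0 β c η ξ T S W' W)
    (hβ : 0 ≤ β) (hη : 0 < η) : ∀ᵐ ω ∂P, ∀ j, 0 < T j ω + β := by
  filter_upwards [ae_arrivals_pos hW.measurable_ξ hW.law_gaps] with ω hω j
  exact (hW.rate_spec hβ hη hω j).1

lemma IsSizeBiasedSample.ae_mixingLaw_eq (hW : IsSizeBiasedSample P 1 0 β c η ξ T S W' W)
    (hβ : 0 ≤ β) (hη : 0 < η) (j : ℕ) :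
    ∀ᵐ ω ∂P, mixingLaw 1 0 (T j ω + β) = mixingKernel (T j ω + β) := by
  filter_upwards [hW.ae_rate_pos hβ hη] with ω hω
  rw [mixingKernel_apply, clampPos_of_pos (hω j)]

variable [IsProbabilityMeasure P]

/-- Together with positivity of the rates, this makes the clamps in `gammaKernel` inactive almost
surely. -/
lemma IsSizeBiasedSample.ae_mem_Ioo (hW : IsSizeBiasedSample P 1 0 β c η ξ T S W' W)
    (hβ : 0 ≤ β) (hη : 0 < η) : ∀ᵐ ω ∂P, ∀ j, S j ω ∈ Ioo (0 : ℝ) 1 := by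
  refine ae_all_iff.2 fun j => ?_
  have h := hW.law_S.map_prodMk (sigmaOf_le hW.measurable_T) hW.measurable_S
    (fun j => (measurable_sigmaOf T j).add_const β) (hW.ae_mixingLaw_eq hβ hη) j
  refine ae_of_ae_map (f := fun ω => (T j ω + β, S j ω)) (p := fun p => p.2 ∈ Ioo (0 : ℝ) 1)
    (((hW.measurable_T j).add_const β).prodMk (hW.measurable_S j)).aemeasurable ?_
  rw [h]
  exact Measure.ae_compProd_of_ae_ae (measurable_snd measurableSet_Ioo)
    (ae_of_all _ fun z => ae_mem_Ioo_mixingKernel z)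

lemma IsSizeBiasedSample.ae_gammaMeasure_eq (hW : IsSizeBiasedSample P 1 0 β c η ξ T S W' W)
    (hβ : 0 ≤ β) (hη : 0 < η) (j : ℕ) :
    ∀ᵐ ω ∂P, gammaMeasure (1 - S j ω) (T j ω + β) = gammaKernel (S j ω, T j ω + β) := by
  filter_upwards [hW.ae_rate_pos hβ hη, hW.ae_mem_Ioo hβ hη] with ω hω hS
  rw [gammaKernel_apply, clampPos_of_pos (hω j), clampPos_of_pos (sub_pos.2 (hS j).2)]

lemma IsSizeBiasedSample.ae_nonneg (hW : IsSizeBiasedSample P 1 0 β c η ξ T S W' W)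
    (hβ : 0 ≤ β) (hη : 0 < η) : ∀ᵐ ω ∂P, ∀ j, 0 ≤ W' j ω := by
  refine ae_all_iff.2 fun j => ?_
  have h := hW.law_W'.map_prodMk hW.sigmaOf_sup_le hW.measurable_W'
    (measurable_sigmaOf_sup T S β) (hW.ae_gammaMeasure_eq hβ hη) j
  refine ae_of_ae_map (f := fun ω => ((S j ω, T j ω + β), W' j ω)) (p := fun p => 0 ≤ p.2)
    (((hW.measurable_S j).prodMk ((hW.measurable_T j).add_const β)).prodMk
      (hW.measurable_W' j)).aemeasurable ?_
  rw [h]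
  exact Measure.ae_compProd_of_ae_ae (measurableSet_le measurable_const measurable_snd)
    (ae_of_all _ fun z => ae_nonneg_gammaMeasure _ _)

lemma IsSizeBiasedSample.ae_geometricDyadicSums_mixing
    (hW : IsSizeBiasedSample P 1 0 β c η ξ T S W' W) (hβ : 0 ≤ β) (hη : 0 < η) {δ : ℝ}
    (hδ : 0 < δ) :
    ∀ᵐ ω ∂P, GeometricDyadicSums fun j =>
      mixingFluctuation (δ * (j + 1)) (T j ω + β, S j ω) := by
  refine hW.law_S.ae_geometricDyadicSums (sigmaOf_le hW.measurable_T) hW.measurable_S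
    (fun j => (measurable_sigmaOf T j).add_const β) (hW.ae_mixingLaw_eq hβ hη)
    (fun j => measurable_mixingFluctuation _) (C := 3 / δ ^ 2) (by positivity)
    (fun j z => integral_mixingFluctuation _ z) (fun j z => ?_)
  rw [div_div, ← mul_pow]
  exact lintegral_sq_mixingFluctuation_le (by positivity) z

lemma IsSizeBiasedSample.ae_geometricDyadicSums_gamma
    (hW : IsSizeBiasedSample P 1 0 β c η ξ T S W' W) (hβ : 0 ≤ β) (hη : 0 < η) {δ : ℝ}
    (hδ : 0 < δ) :
    ∀ᵐ ω ∂P, GeometricDyadicSums fun j =>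
      gammaFluctuation (δ * (j + 1)) ((S j ω, T j ω + β), W' j ω) := by
  refine hW.law_W'.ae_geometricDyadicSums hW.sigmaOf_sup_le hW.measurable_W'
    (measurable_sigmaOf_sup T S β) (hW.ae_gammaMeasure_eq hβ hη)
    (fun j => measurable_gammaFluctuation _) (C := 3 / δ ^ 2) (by positivity)
    (fun j p => integral_gammaFluctuation (by positivity) p) (fun j p => ?_)
  rw [div_div, ← mul_pow]
  exact lintegral_sq_gammaFluctuation_le (by positivity) p

lemma IsSizeBiasedSample.ae_summable_and_tendsto
    (hW : IsSizeBiasedSample P 1 0 β c η ξ T S W' W) (hβ : 0 ≤ β) (hη : 0 < η) :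
    ∀ᵐ ω ∂P, Summable (fun j => W' j ω) ∧
      Tendsto (fun n : ℕ => (∑' j, W' (n + j) ω) * Real.log n) atTop (𝓝 η) := by
  -- Eventually Z_n ≥ ψ(Z_n) ≥ ξ_n/η and ξ_n > 3n/4 ≥ (n + 1)/2, which dictates this slope for the
  -- cutoff.
  have hδ : 0 < 1 / (2 * η) := by positivity
  filter_upwards [ae_arrivals_pos hW.measurable_ξ hW.law_gaps,
    ae_tendsto_arrivals_div hW.measurable_ξ hW.indep_gaps hW.law_gaps,
    hW.ae_mem_Ioo hβ hη, hW.ae_nonneg hβ hη, hW.ae_geometricDyadicSums_mixing hβ hη hδ,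
    hW.ae_geometricDyadicSums_gamma hβ hη hδ] with ω hpos hξ hS hW0 hmix hgam
  have hspec := hW.rate_spec hβ hη hpos
  have hcast := tendsto_natCast_atTop_atTop (R := ℝ)
  have hY : Tendsto (fun n : ℕ => (ξ n ω / η + mStLaplaceExponent 1 0 β) / n) atTop
      (𝓝 (1 / η)) := by
    have h := (hξ.div_const η).add (tendsto_const_nhds.div_atTop hcast
      (a := mStLaplaceExponent 1 0 β))
    rw [add_zero] at h
    refine h.congr fun n => ?_
    ring
  obtain ⟨hle, hmean⟩ := tendsto_weightMean_mul hη hY (fun n => (hspec n).1.le)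
    fun n => (hspec n).2
  have hlarge : ∀ᶠ n : ℕ in atTop, 1 / (2 * η) * ((n : ℝ) + 1) ≤ T n ω + β := by
    filter_upwards [hle, hξ.eventually_const_lt (show (3 / 4 : ℝ) < 1 by norm_num),
      hcast.eventually_ge_atTop 2] with n h1 h2 h3
    have h4 := mStLaplaceExponent_nonneg hβ
    rw [lt_div_iff₀ (by linarith)] at h2
    calc 1 / (2 * η) * ((n : ℝ) + 1) = ((n : ℝ) + 1) / 2 / η := by field_simp
      _ ≤ ξ n ω / η := by gcongr; linarith
      _ ≤ _ := by linarith
  -- Beyond the cutoff the two fluctuations add up to W' - m(Z), the terms (1 - S)/Z cancelling.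
  refine summable_and_tendsto_tail_mul_log hW0 hmean ((hgam.add hmix).congr ?_)
  filter_upwards [hlarge] with n hn
  rw [gammaFluctuation, mixingFluctuation, if_pos hn, if_pos ⟨hn, (hS n).2, (hS n).1⟩]
  ring

end SizeBiased

theorem proposition4 {Ω : Type*} [MeasurableSpace Ω] (P : Measure Ω) [IsProbabilityMeasure P]
    (β c η : ℝ) (hβ : 0 ≤ β) (hc : 0 < c) (hη : 0 < η)
    (ξ T S W' W : ℕ → Ω → ℝ) (hW : IsSizeBiasedSample P 1 0 β c η ξ T S W' W) :
    ∀ᵐ ω ∂P, Summable (fun j => W j ω) ∧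
      (fun n : ℕ => remainingMass W n ω) ~[atTop] fun n : ℕ => c * η / Real.log n := by
  filter_upwards [hW.ae_summable_and_tendsto hβ hη] with ω ⟨hs, ht⟩
  simp only [remainingMass, hW.W_eq, tsum_mul_left]
  refine ⟨hs.mul_left c, isEquivalent_of_tendsto_one ?_⟩
  have h := ht.div_const η
  rw [div_self hη.ne'] at h
  refine h.congr' ?_
  filter_upwards [tendsto_log_natCast.eventually_gt_atTop 0] with n hn
  simp only [Pi.div_apply]
  field_simp
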